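/- Let $G$ be a countable group and let $\mu$ be a probability measure on $G$ whose support generates $G$ as a semigroup. A $G$-space $(X,\nu)$ is a measurable space $X$ with a probability measure $\nu$ and an action of $G$ by measurable maps which preserve the class of $\nu$-null sets. It is ergodic if every measurable $B\subset X$ with $\nu(B\,\Delta\,gB)=0$ for all $g\in G$ is $\nu$-null or $\nu$-conull. It is probability measure-preserving if $g_*\nu=\nu$ for all $g\in G$, and it is a $(G,\mu)$-space if $$\sum_{s\in G}\Big(\int_X f(sx)\,d\nu(x)\Big)\mu(s)=\int_X f\,d\nu\qquad\text{for all real-valued } f\in L^\infty(X,\nu).$$ A factor of $(X,\nu)$ is a $G$-space $(W,\xi)$ together with a $G$-equivariant measurable map $p:X'\to W$, defined on a measurable $G$-invariant $\nu$-conull set $X'\subset X$, such that $p_*\nu=\xi$. It is non-trivial if $\xi$ is not concentrated on a single point. Two $G$-spaces $(X,\nu)$ and $(W,\xi)$ are isomorphic if there is a $G$-equivariant bijection, measurable in both directions and carrying $\nu$ to $\xi$, between measurable $G$-invariant conull subsets of $X$ and $W$. A $G$-space is isometric if it is isomorphic to $(K/L,m_{K/L})$ for some compact second countable Hausdorff group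 $K$, some closed subgroup $L$ of $K$ and some homomorphism $\tau:G\to K$ with dense image, where $m_{K/L}$ is the Haar probability measure on $K/L$ and $G$ acts by $g\cdot kL=\tau(g)kL$. **Theorem.** Let $(X,\nu)$ be an ergodic $(G,\mu)$-space and let $(Y,\eta)$ be an ergodic probability measure-preserving $G$-space. Suppose that the diagonal action of $G$ on $(X\times Y,\nu\otimes\eta)$ is not ergodic. Then there exists a non-trivial factor $(W,\xi)$ of $(X,\nu)$, with $W$ a standard Borel space, which is an isometric $G$-space. -/

import Mathlib

open MeasureTheory Set

namespace GDyn

universe u v w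

/-- `(X, ν)` is a `G`-space: `ν` is a probability measure and every `g : G` acts by a measurable
map which preserves the class of `ν`-null sets (inverses are covered by `g⁻¹`). No regularity
of the measurable space `X` is imposed. -/
structure IsGSpace (G : Type u) {X : Type v} [Group G] [MeasurableSpace X] [MulAction G X]
    (ν : Measure X) : Prop where
  isProbabilityMeasure : IsProbabilityMeasure ν
  quasi : ∀ g : G, Measure.QuasiMeasurePreserving (fun x : X => g • x) ν ν

/-- Every measurable set `B` with `ν (B ∆ g B) = 0` for all `g` is null or conull. -/
def IsErgodic (G : Type u) {X : Type v} [Group G] [MeasurableSpace X] [MulAction G X]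
    (ν : Measure X) : Prop :=
  ∀ B : Set X, MeasurableSet B → (∀ g : G, ν (symmDiff B ((fun x : X => g • x) '' B)) = 0) →
    ν B = 0 ∨ ν Bᶜ = 0

/-- `(X, ν)` is a `(G, μ)`-space: a `G`-space whose measure is `μ`-stationary, that is
`∑ₛ (∫ f (s x) dν(x)) μ(s) = ∫ f dν` for every essentially bounded real function `f`. -/
structure IsStationarySpace {G : Type u} {X : Type v} [Group G] [MeasurableSpace X]
    [MulAction G X] (μ : PMF G) (ν : Measure X) : Prop extends IsGSpace G ν where
  stationary : ∀ f : X → ℝ, MemLp f ⊤ ν →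
    HasSum (fun s : G => (∫ x, f (s • x) ∂ν) * (μ s).toReal) (∫ x, f x ∂ν)

/-- The `G`-space `(W, ξ)` is a factor of the `G`-space `(X, ν)`: there is a measurable map `p`
carrying `ν` to `ξ` which is `G`-equivariant on a `G`-invariant `ν`-conull set `X'`. (A map that is
only defined on `X'` is extended to `X` by a constant.) -/
def IsFactor (G : Type u) {X : Type v} {W : Type w} [Group G]
    [MeasurableSpace X] [MulAction G X] [MeasurableSpace W] [MulAction G W]
    (ν : Measure X) (ξ : Measure W) : Prop :=
  ∃ (X' : Set X) (p : X → W), MeasurableSet X' ∧ ν X'ᶜ = 0 ∧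
    (∀ g : G, ∀ x ∈ X', g • x ∈ X') ∧
    Measurable p ∧ (∀ g : G, ∀ x ∈ X', p (g • x) = g • p x) ∧
    ν.map p = ξ

/-- `(X, ν)` and `(W, ξ)` are isomorphic `G`-spaces: a factor map restricts to a bijection between
`G`-invariant conull sets, with a measurable inverse carrying `ξ` back to `ν`. -/
def IsIsomorphic (G : Type u) {X : Type v} {W : Type w} [Group G]
    [MeasurableSpace X] [MulAction G X] [MeasurableSpace W] [MulAction G W]
    (ν : Measure X) (ξ : Measure W) : Prop :=
  ∃ (X' : Set X) (W' : Set W) (p : X → W) (q : W → X),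
    MeasurableSet X' ∧ ν X'ᶜ = 0 ∧ (∀ g : G, ∀ x ∈ X', g • x ∈ X') ∧
    MeasurableSet W' ∧ ξ W'ᶜ = 0 ∧ (∀ g : G, ∀ y ∈ W', g • y ∈ W') ∧
    Measurable p ∧ Measurable q ∧ MapsTo p X' W' ∧ MapsTo q W' X' ∧
    LeftInvOn q p X' ∧ LeftInvOn p q W' ∧
    (∀ g : G, ∀ x ∈ X', p (g • x) = g • p x) ∧
    ν.map p = ξ ∧ ξ.map q = ν

/-- The measure is concentrated on one point. -/
def IsTrivial {W : Type w} [MeasurableSpace W] (ξ : Measure W) : Prop :=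
  ∃ w : W, ∀ᵐ y ∂ξ, y = w

/-- The coset space `K ⧸ L`, as a space on which `G` acts through the homomorphism `τ`. -/
def CosetSpace {G : Type u} {K : Type v} [Group G] [Group K] (L : Subgroup K) (_τ : G →* K) :
    Type v :=
  K ⧸ L

section CosetSpace

variable {G : Type u} {K : Type v} [Group G] [Group K]

/-- The projection `k ↦ kL`. -/
def CosetSpace.mk (L : Subgroup K) (τ : G →* K) (k : K) : CosetSpace L τ :=
  (QuotientGroup.mk k : K ⧸ L)

/-- `g • kL = τ(g)kL`. -/
instance (L : Subgroup K) (τ : G →* K) : MulAction G (CosetSpace L τ) :=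
  MulAction.compHom (K ⧸ L) τ

/-- The quotient topology. -/
instance [TopologicalSpace K] (L : Subgroup K) (τ : G →* K) :
    TopologicalSpace (CosetSpace L τ) :=
  inferInstanceAs (TopologicalSpace (K ⧸ L))

/-- The Borel sets of the quotient topology. -/
instance [TopologicalSpace K] (L : Subgroup K) (τ : G →* K) :
    MeasurableSpace (CosetSpace L τ) :=
  borel (CosetSpace L τ)

/-- The Haar probability measure on `K ⧸ L`: the image of the Haar measure of `K`, normalised to
have total mass one, under the projection `k ↦ kL`. -/
noncomputable def cosetHaar [TopologicalSpace K] [IsTopologicalGroup K] [CompactSpace K]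
    (L : Subgroup K) (τ : G →* K) : Measure (CosetSpace L τ) :=
  letI : MeasurableSpace K := borel K
  haveI : BorelSpace K := ⟨rfl⟩
  (Measure.haarMeasure (⊤ : TopologicalSpace.PositiveCompacts K)).map
    (CosetSpace.mk L τ)

end CosetSpace

/-- `(W, ξ)` is an isometric `G`-space: it is isomorphic to `K ⧸ L` with its Haar probability
measure, for some compact second countable (Hausdorff) group `K`, closed subgroup `L` of `K`, and
homomorphism `τ : G → K` with dense image. (Such a `K` has at most continuum many elements, so
the universe of `K` is no restriction.) -/
def IsIsometric (G : Type u) {W : Type w} [Group G] [MeasurableSpace W] [MulAction G W]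
    (ξ : Measure W) : Prop :=
  ∃ (K : Type) (_ : Group K) (_ : TopologicalSpace K) (_ : IsTopologicalGroup K)
    (_ : CompactSpace K) (_ : T2Space K) (_ : SecondCountableTopology K)
    (L : Subgroup K) (τ : G →* K),
    IsClosed (L : Set K) ∧ DenseRange τ ∧ IsIsomorphic G ξ (cosetHaar L τ)

end GDyn

/-! Let `B` be an almost invariant set in the product, neither null nor conull. Its sections give a
map `φ : X → L²(Y, η)`, `x ↦ 1_{B_x}`, equivariant for the Koopman representation `π`. Were almost
all values `π`-invariant, ergodicity of `η` would make almost every section null or conull, and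
ergodicity of `ν` would make `B` null or conull.

Remove the invariant part of `φ` by orthogonal projection. The form `q(u) = ∫ ⟪φ x, u⟫² dν` belongs
to a nonzero compact positive operator `C`, and stationarity says that `q(u)` is the `μ`-average of
`q(π(s)⁻¹u)`. By the maximum principle the top eigenspace of `C`, which is finite-dimensional, is
`G`-invariant (`exists_finiteDimensional_invariant`).

Projecting `φ` there gives an equivariant `ψ` into a Euclidean space on which `G` acts through a
compact group `K`, the closure of its image. By ergodicity `ψ` lives on one `K`-orbit
(`exists_ae_mem_orbit`); by the maximum principle on `K` its law is `K`-invariant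
(`integral_smul_eq`), hence the Haar measure of that orbit. -/

namespace GDyn

/-! ### Covariance operators and their top eigenvalue -/

section Covariance

open InnerProductSpace Module.End

variable {X : Type*} [MeasurableSpace X] {H : Type*} [NormedAddCommGroup H]
  [InnerProductSpace ℝ H]

/-- The covariance operator `u ↦ ∫ ⟪φ x, u⟫ φ x dν(x)` of a Hilbert space valued map. -/
noncomputable def covariance (ν : Measure X) (φ : X → H) : H →L[ℝ] H :=
  ∫ x, rankOne ℝ (φ x) (φ x) ∂ν

theorem isCompactOperator_rankOne (u v : H) : IsCompactOperator (rankOne ℝ u v) := by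
  rw [rankOne_def']
  exact (isCompactOperator_of_locallyCompactSpace_dom (innerSL ℝ v)).clm_comp
    (ContinuousLinearMap.toSpanSingleton ℝ u)

/-- Equality case of `inner_apply_self_le`: expanding `‖C u - ‖C‖ u‖²` leaves a quantity at most
`0`. The eigenspace becomes the set where a quadratic form is extremal, as the maximum principle
requires. -/
theorem mem_eigenspace_norm_iff {C : H →L[ℝ] H} (u : H) :
    u ∈ eigenspace (C : Module.End ℝ H) ‖C‖ ↔ inner ℝ (C u) u = ‖C‖ * ‖u‖ ^ 2 := by
  rw [mem_eigenspace_iff]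
  simp only [ContinuousLinearMap.coe_coe]
  constructor
  · intro h
    rw [h, real_inner_smul_left, real_inner_self_eq_norm_sq]
  · intro h
    have h1 : ‖C u - ‖C‖ • u‖ ^ 2 ≤ 0 := by
      rw [norm_sub_sq_real, inner_smul_right, h, norm_smul, norm_norm]
      have := C.le_opNorm u
      have : ‖C u‖ ^ 2 ≤ (‖C‖ * ‖u‖) ^ 2 := by gcongr
      nlinarith
    have h2 := pow_eq_zero_iff (two_ne_zero) |>.1 (le_antisymm h1 (sq_nonneg _))
    exact sub_eq_zero.1 (norm_eq_zero.1 h2)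

theorem inner_apply_self_le (C : H →L[ℝ] H) (u : H) : inner ℝ (C u) u ≤ ‖C‖ * ‖u‖ ^ 2 := by
  calc inner ℝ (C u) u ≤ ‖C u‖ * ‖u‖ := real_inner_le_norm _ _
    _ ≤ (‖C‖ * ‖u‖) * ‖u‖ := by gcongr; exact C.le_opNorm u
    _ = _ := by ring

variable {ν : Measure X} [IsProbabilityMeasure ν] {φ : X → H}

theorem integrable_rankOne (hφ : StronglyMeasurable φ) {c : ℝ} (hc : ∀ x, ‖φ x‖ ≤ c) :
    Integrable (fun x => rankOne ℝ (φ x) (φ x)) ν := by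
  have hcont : Continuous fun u : H => rankOne ℝ u u :=
    (rankOne ℝ (E := H) (F := H)).continuous.clm_apply continuous_id
  refine Integrable.of_bound (hcont.comp_stronglyMeasurable hφ).aestronglyMeasurable (c * c)
    (Filter.Eventually.of_forall fun x => ?_)
  rw [norm_rankOne]
  exact mul_le_mul (hc x) (hc x) (norm_nonneg _) ((norm_nonneg _).trans (hc x))

variable [CompleteSpace H]

theorem inner_covariance_apply (hφ : StronglyMeasurable φ) {c : ℝ} (hc : ∀ x, ‖φ x‖ ≤ c)
    (u v : H) :
    inner ℝ (covariance ν φ u) v = ∫ x, inner ℝ (φ x) u * inner ℝ (φ x) v ∂ν := by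
  have hi := integrable_rankOne (ν := ν) hφ hc
  rw [covariance, ContinuousLinearMap.integral_apply hi, real_inner_comm, ← integral_inner]
  · refine integral_congr_ae (Filter.Eventually.of_forall fun x => ?_)
    simp only [rankOne_apply, inner_smul_right]
    rw [real_inner_comm v]
  · exact (ContinuousLinearMap.apply ℝ H u).integrable_comp hi

/-- Compact operators form a closed subspace, so an integral of rank one operators stays in it. -/
theorem isCompactOperator_covariance (hφ : StronglyMeasurable φ) {c : ℝ}
    (hc : ∀ x, ‖φ x‖ ≤ c) : IsCompactOperator (covariance ν φ) := by
  have h : covariance ν φ ∈ (compactOperator (RingHom.id ℝ) H H : Set (H →L[ℝ] H)) := by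
    refine Convex.integral_mem (Submodule.convex _) ?_ ?_ (integrable_rankOne hφ hc)
    · exact isClosed_setOfPred_isCompactOperator
    · exact Filter.Eventually.of_forall fun x => isCompactOperator_rankOne _ _
  exact h

theorem isSymmetric_covariance (hφ : StronglyMeasurable φ) {c : ℝ} (hc : ∀ x, ‖φ x‖ ≤ c) :
    (covariance ν φ).IsSymmetric := fun u v => by
  rw [real_inner_comm]
  simp only [ContinuousLinearMap.coe_coe]
  rw [real_inner_comm, inner_covariance_apply hφ hc, real_inner_comm,
    inner_covariance_apply hφ hc]
  simp only [mul_comm]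

/-- A compact operator with nonnegative quadratic form has its norm as an eigenvalue. -/
theorem hasEigenvalue_norm {C : H →L[ℝ] H} (hC : IsCompactOperator C) (hs : C.IsSymmetric)
    (hpos : ∀ u, 0 ≤ inner ℝ (C u) u) (h0 : C ≠ 0) : HasEigenvalue (C : Module.End ℝ H) ‖C‖ := by
  have hn : ‖C‖ ≠ 0 := norm_ne_zero_iff.2 h0
  rw [hC.hasEigenvalue_iff_mem_spectrum hn]
  have : Nontrivial H := by
    by_contra hH
    rw [not_nontrivial_iff_subsingleton] at hH
    exact h0 (Subsingleton.elim _ _)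
  by_contra hmem
  -- Were `‖C‖` in the resolvent set, Rayleigh quotients would stay below `‖C‖ - ε`; by symmetry and
  -- positivity their supremum is `‖C‖`.
  obtain ⟨ε, hε, h⟩ := C.rayleighQuotient_le_of_norm_mem_resolventSet (𝕜 := ℝ) (by
    simpa [spectrum] using hmem)
  have h2 : ‖C‖ ≤ ‖C‖ - ε := by
    conv_lhs => rw [C.norm_eq_iSup_rayleighQuotient hs]
    refine ciSup_le fun x => ?_
    rw [abs_of_nonneg]
    · exact h x
    · exact div_nonneg (hpos x) (sq_nonneg _)
  linarith

end Covariance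

/-! ### The maximum principle and the invariant eigenspace -/

section Invariance

theorem hasSum_pmf_toReal {G : Type*} (μ : PMF G) : HasSum (fun s => (μ s).toReal) 1 := by
  have h := ENNReal.hasSum_toReal (f := μ) (by rw [μ.tsum_coe]; exact ENNReal.one_ne_top)
  rwa [← ENNReal.tsum_toReal_eq (fun a => μ.apply_ne_top a), μ.tsum_coe, ENNReal.toReal_one] at h

/-- If an average of numbers at most `c` equals `c`, then all of them are equal to `c`. -/
theorem eq_of_hasSum_average_eq_max {G : Type*} (μ : PMF G) {F : G → ℝ} {c : ℝ}
    (hF : ∀ s, F s ≤ c) (h : HasSum (fun s => F s * (μ s).toReal) c) :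
    ∀ s ∈ μ.support, F s = c := by
  have h1 : HasSum (fun s => (c - F s) * (μ s).toReal) 0 := by
    have := ((hasSum_pmf_toReal μ).mul_left c).sub h
    simpa only [mul_one, sub_self, ← sub_mul] using this
  intro s hs
  have h2 := (hasSum_zero_iff_of_nonneg fun s =>
    mul_nonneg (sub_nonneg.2 (hF s)) ENNReal.toReal_nonneg).1 h1
  have h3 : (c - F s) * (μ s).toReal = 0 := congrFun h2 s
  have h4 : (μ s).toReal ≠ 0 :=
    ENNReal.toReal_ne_zero.2 ⟨(μ.mem_support_iff s).1 hs, μ.apply_ne_top s⟩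
  have := (mul_eq_zero.1 h3).resolve_right h4
  linarith

theorem forall_of_subsemigroup_closure {G : Type*} [Group G] {S : Set G}
    (hS : Subsemigroup.closure S = ⊤) {p : G → Prop} (h1 : ∀ s ∈ S, p s)
    (h2 : ∀ g h, p g → p h → p (g * h)) (g : G) : p g := by
  have hg : g ∈ Subsemigroup.closure S := hS ▸ Subsemigroup.mem_top g
  induction hg using Subsemigroup.closure_induction with
  | mem x hx => exact h1 x hx
  | mul x y _ _ hx hy => exact h2 x y hx hy

open Module.End in
-- `V` is the eigenspace of the covariance operator for its norm. The last clause holds because `V`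
-- lies in the range of a symmetric operator whose kernel contains `w`; it later shows both that `V`
-- avoids invariant vectors and that `φ` is not orthogonal to `V`.
theorem exists_finiteDimensional_invariant {G : Type*} [Group G] (μ : PMF G)
    (hμ : Subsemigroup.closure μ.support = ⊤) {X : Type*} [MeasurableSpace X] {ν : Measure X}
    [IsProbabilityMeasure ν] {H : Type*} [NormedAddCommGroup H] [InnerProductSpace ℝ H]
    [CompleteSpace H] (π : G →* (H ≃ₗᵢ[ℝ] H)) {φ : X → H} (hφ : StronglyMeasurable φ) {c : ℝ}
    (hc : ∀ x, ‖φ x‖ ≤ c) (h0 : ¬ φ =ᵐ[ν] 0)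
    (hstat : ∀ u : H, HasSum (fun s => (∫ x, inner ℝ (φ x) (π s⁻¹ u) ^ 2 ∂ν) * (μ s).toReal)
      (∫ x, inner ℝ (φ x) u ^ 2 ∂ν)) :
    ∃ V : Submodule ℝ H, FiniteDimensional ℝ V ∧ V ≠ ⊥ ∧ (∀ g, ∀ u ∈ V, π g u ∈ V) ∧
      ∀ w, (∀ᵐ x ∂ν, inner ℝ (φ x) w = 0) → ∀ u ∈ V, inner ℝ u w = 0 := by
  set C := covariance ν φ with hC
  have hQ (u : H) : ∫ x, inner ℝ (φ x) u ^ 2 ∂ν = inner ℝ (C u) u := by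
    rw [hC, inner_covariance_apply hφ hc]
    simp only [sq]
  have hker (w : H) (hw : ∀ᵐ x ∂ν, inner ℝ (φ x) w = 0) : C w = 0 := by
    rw [← inner_self_eq_zero (𝕜 := ℝ), hC, inner_covariance_apply hφ hc]
    refine integral_eq_zero_of_ae ?_
    filter_upwards [hw] with x hx
    simp [hx]
  have hint (u : H) : Integrable (fun x => inner ℝ (φ x) u ^ 2) ν := by
    refine Integrable.of_bound (((hφ.inner stronglyMeasurable_const).pow 2).aestronglyMeasurable)
      ((c * ‖u‖) ^ 2) (Filter.Eventually.of_forall fun x => ?_)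
    rw [norm_pow]
    gcongr
    exact (norm_inner_le_norm _ _).trans (by gcongr; exact hc x)
  have hcpt := isCompactOperator_covariance (ν := ν) hφ hc
  have hsymm := isSymmetric_covariance (ν := ν) hφ hc
  have hC0 : C ≠ 0 := by
    intro hz
    refine h0 (ae_eq_zero_of_forall_dual_of_isSeparable ℝ hφ.isSeparable_range (fun l => ?_)
      (Filter.Eventually.of_forall fun x => mem_range_self x))
    have h1 : ∫ x, inner ℝ (φ x) ((InnerProductSpace.toDual ℝ H).symm l) ^ 2 ∂ν = 0 := by
      rw [hQ, hz]; simp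
    rw [integral_eq_zero_iff_of_nonneg (fun x => sq_nonneg _) (hint _)] at h1
    filter_upwards [h1] with x hx
    have h2 : inner ℝ (φ x) ((InnerProductSpace.toDual ℝ H).symm l) = 0 := by simpa using hx
    rw [real_inner_comm, InnerProductSpace.toDual_symm_apply] at h2
    simpa using h2
  have hn : ‖C‖ ≠ 0 := norm_ne_zero_iff.2 hC0
  refine ⟨eigenspace (C : Module.End ℝ H) ‖C‖,
    C.finite_dimensional_eigenspace hcpt _ hn, ?_, ?_, ?_⟩
  · exact hasEigenvalue_norm hcpt hsymm
      (fun u => by rw [← hQ]; exact integral_nonneg fun x => sq_nonneg _) hC0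
  -- Inverses appear because stationarity moves `u` by `π s⁻¹`; the property is multiplicative in
  -- `g`, so generation as a semigroup suffices.
  · have key : ∀ g, ∀ u ∈ eigenspace (C : Module.End ℝ H) ‖C‖,
        π g⁻¹ u ∈ eigenspace (C : Module.End ℝ H) ‖C‖ := by
      refine forall_of_subsemigroup_closure hμ ?_ ?_
      · intro s hs u hu
        have h1 := hstat u
        simp only [hQ] at h1
        rw [(mem_eigenspace_norm_iff u).1 hu] at h1
        have h2 := eq_of_hasSum_average_eq_max μ (fun t => by
          simpa using inner_apply_self_le C (π t⁻¹ u)) h1 s hs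
        rw [mem_eigenspace_norm_iff, h2, LinearIsometryEquiv.norm_map]
      · intro g h hg hh u hu
        rw [mul_inv_rev, map_mul]
        exact hh _ (hg _ hu)
    intro g u hu
    simpa using key g⁻¹ u hu
  · intro w hw u hu
    have h1 : C u = ‖C‖ • u := mem_eigenspace_iff.1 hu
    have h2 : inner ℝ (C u) w = 0 := by
      have := hsymm u w
      simp only [ContinuousLinearMap.coe_coe] at this
      rw [this, hker w hw, inner_zero_right]
    rw [h1, real_inner_smul_left] at h2
    exact (mul_eq_zero.1 h2).resolve_left hn

end Invariance

/-! ### Ergodicity for almost invariant sets -/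

section Ergodic

theorem image_smul_eq_preimage {G X : Type*} [Group G] [MulAction G X] (g : G) (B : Set X) :
    (fun x : X => g • x) '' B = (fun x : X => g⁻¹ • x) ⁻¹' B := by
  ext x
  constructor
  · rintro ⟨y, hy, rfl⟩
    simpa using hy
  · intro hx
    exact ⟨g⁻¹ • x, hx, by simp⟩

variable {G X : Type*} [Group G] [MeasurableSpace X] [MulAction G X] {ν : Measure X}

theorem measure_symmDiff_smul_eq_zero_iff (g : G) (B : Set X) :
    ν (symmDiff B ((fun x : X => g • x) '' B)) = 0 ↔ ∀ᵐ x ∂ν, (g⁻¹ • x ∈ B ↔ x ∈ B) := by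
  rw [image_smul_eq_preimage, measure_symmDiff_eq_zero_iff, Filter.eventuallyEq_set]
  simp only [mem_preimage, iff_comm]

/-- Ergodicity applied to a set which is invariant up to null sets. -/
theorem IsErgodic.measure_eq_zero_or (h : IsErgodic G ν) {B : Set X} (hB : MeasurableSet B)
    (hinv : ∀ g : G, ∀ᵐ x ∂ν, (g • x ∈ B ↔ x ∈ B)) : ν B = 0 ∨ ν Bᶜ = 0 :=
  h B hB fun g => (measure_symmDiff_smul_eq_zero_iff g B).2 (hinv g⁻¹)

end Ergodic

/-! ### Harmonic functions and Haar measure on compact groups -/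

/-- A continuous function on a compact group which is harmonic along a dense subgroup is
constant. -/
theorem eq_of_harmonic {G : Type*} [Group G] (μ : PMF G)
    (hμ : Subsemigroup.closure μ.support = ⊤) {K : Type*} [Group K] [TopologicalSpace K]
    [IsTopologicalGroup K] [CompactSpace K] {τ : G →* K} (hτ : DenseRange τ) {F : K → ℝ}
    (hF : Continuous F) (h : ∀ k, HasSum (fun s => F (k * τ s) * (μ s).toReal) (F k))
    (k l : K) : F k = F l := by
  obtain ⟨m, -, hm⟩ := isCompact_univ.exists_isMaxOn univ_nonempty hF.continuousOn
  have hmax (k : K) : F k ≤ F m := hm (mem_univ k)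
  -- Maximum points are stable under right translation by `τ g`; from `m` they are dense, and they
  -- form a closed set.
  have key : ∀ g, ∀ k, F k = F m → F (k * τ g) = F m := by
    refine forall_of_subsemigroup_closure hμ ?_ ?_
    · intro s hs k hk
      exact eq_of_hasSum_average_eq_max μ (fun s => hmax (k * τ s)) (hk ▸ h k) s hs
    · intro g g' hg hg' k hk
      rw [map_mul, ← mul_assoc]
      exact hg' _ (hg _ hk)
  have hconst (k : K) : F (m * k) = F m := by
    have hcl : IsClosed {k | F (m * k) = F m} :=
      isClosed_eq (hF.comp (continuous_const_mul m)) continuous_const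
    have hsub : closure (range τ) ⊆ {k | F (m * k) = F m} :=
      closure_minimal (by rintro _ ⟨g, rfl⟩; exact key g m rfl) hcl
    exact hsub (hτ k)
  have h1 := hconst (m⁻¹ * k)
  have h2 := hconst (m⁻¹ * l)
  rw [mul_inv_cancel_left] at h1 h2
  rw [h1, h2]

theorem haarMeasure_map_mul_right {K : Type*} [Group K] [TopologicalSpace K]
    [IsTopologicalGroup K] [CompactSpace K] [MeasurableSpace K] [BorelSpace K] (k : K) :
    (Measure.haarMeasure (⊤ : TopologicalSpace.PositiveCompacts K)).map (· * k) =
      Measure.haarMeasure ⊤ := by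
  have : IsProbabilityMeasure (Measure.haarMeasure (⊤ : TopologicalSpace.PositiveCompacts K)) :=
    ⟨by simpa using Measure.haarMeasure_self (K₀ := (⊤ : TopologicalSpace.PositiveCompacts K))⟩
  have : IsProbabilityMeasure
      ((Measure.haarMeasure (⊤ : TopologicalSpace.PositiveCompacts K)).map (· * k)) :=
    Measure.isProbabilityMeasure_map (measurable_mul_const k).aemeasurable
  exact Measure.isHaarMeasure_eq_of_isProbabilityMeasure _ _

theorem isCompact_orbit {K E : Type*} [Group K] [TopologicalSpace K] [CompactSpace K]
    [TopologicalSpace E] [MulAction K E] [ContinuousSMul K E] (w : E) :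
    IsCompact (MulAction.orbit K w) :=
  isCompact_range (continuous_id.smul continuous_const)

theorem cosetHaar_eq_map {G K : Type*} [Group G] [Group K] [TopologicalSpace K]
    [IsTopologicalGroup K] [CompactSpace K] [mK : MeasurableSpace K] [hK : BorelSpace K]
    (L : Subgroup K) (τ : G →* K) :
    cosetHaar L τ = (Measure.haarMeasure (⊤ : TopologicalSpace.PositiveCompacts K)).map
      (CosetSpace.mk L τ) := by
  obtain rfl : mK = borel K := hK.measurable_eq
  rfl

/-! ### Equivariant maps concentrate on one orbit, with Haar law -/

section Orbit

variable {G : Type*} [Group G] {X : Type*} [MeasurableSpace X] [MulAction G X] {ν : Measure X}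
  {K : Type*} [Group K] [TopologicalSpace K] [CompactSpace K]
  {τ : G →* K} {E : Type*} [MetricSpace E] [MeasurableSpace E]
  [BorelSpace E] [MulAction K E] [ContinuousSMul K E] {ψ : X → E}

/-- The distance to a `K`-orbit is `K`-invariant, so its sublevel sets pull back to almost invariant
sets. Taking `w` in the support of the image measure keeps them from being null. -/
theorem exists_ae_mem_orbit [SecondCountableTopology E] [IsIsometricSMul K E] [IsProbabilityMeasure ν]
    (hν : IsErgodic G ν) (hψ : Measurable ψ)
    (hequiv : ∀ g : G, ∀ᵐ x ∂ν, ψ (g • x) = τ g • ψ x) :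
    ∃ w : E, ∀ᵐ x ∂ν, ψ x ∈ MulAction.orbit K w := by
  have : IsProbabilityMeasure (ν.map ψ) := Measure.isProbabilityMeasure_map hψ.aemeasurable
  obtain ⟨w, -, hw⟩ := exists_mem_forall_mem_nhdsWithin_pos_measure (μ := ν.map ψ) (s := univ)
    (by simp)
  refine ⟨w, ?_⟩
  have hne : (MulAction.orbit K w).Nonempty := MulAction.nonempty_orbit w
  have hinf (k : K) (v : E) : Metric.infDist (k • v) (MulAction.orbit K w) =
      Metric.infDist v (MulAction.orbit K w) := by
    conv_lhs => rw [← MulAction.smul_orbit k w]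
    exact Metric.infDist_image (isometry_smul E k)
  have hm : Measurable fun x => Metric.infDist (ψ x) (MulAction.orbit K w) :=
    (Metric.continuous_infDist_pt _).measurable.comp hψ
  have key (ε : ℝ) (hε : 0 < ε) : ∀ᵐ x ∂ν, Metric.infDist (ψ x) (MulAction.orbit K w) < ε := by
    have hB : MeasurableSet {x | Metric.infDist (ψ x) (MulAction.orbit K w) < ε} :=
      measurableSet_lt hm measurable_const
    refine (hν.measure_eq_zero_or hB fun g => ?_).resolve_left ?_
    · filter_upwards [hequiv g] with x hx
      simp only [hx, hinf]
    · have hopen : IsOpen {v : E | Metric.infDist v (MulAction.orbit K w) < ε} :=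
        isOpen_lt (Metric.continuous_infDist_pt _) continuous_const
      have h1 := hw _ (mem_nhdsWithin_of_mem_nhds (hopen.mem_nhds (by
        simpa [Metric.infDist_zero_of_mem (MulAction.mem_orbit_self w)] using hε)))
      rw [Measure.map_apply hψ hopen.measurableSet] at h1
      exact h1.ne'
  have h2 : ∀ᵐ x ∂ν, ∀ n : ℕ, Metric.infDist (ψ x) (MulAction.orbit K w) < 1 / ((n : ℝ) + 1) :=
    ae_all_iff.2 fun n => key _ Nat.one_div_pos_of_nat
  filter_upwards [h2] with x hx
  rw [(isCompact_orbit w).isClosed.mem_iff_infDist_zero hne]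
  refine le_antisymm (le_of_forall_pos_le_add fun ε hε => ?_) Metric.infDist_nonneg
  obtain ⟨n, hn⟩ := exists_nat_one_div_lt hε
  rw [zero_add]
  exact ((hx n).trans hn).le

/-- As a function of `k` the left side is continuous, and stationarity with equivariance makes it
harmonic: `eq_of_harmonic` applies. -/
theorem integral_smul_eq [IsTopologicalGroup K] [FirstCountableTopology K] {μ : PMF G} (hμ : Subsemigroup.closure μ.support = ⊤)
    (hν : IsStationarySpace μ ν) (hτ : DenseRange τ) (hψ : Measurable ψ)
    (hequiv : ∀ g : G, ∀ᵐ x ∂ν, ψ (g • x) = τ g • ψ x) (f : BoundedContinuousFunction E ℝ)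
    (k : K) : ∫ x, f (k • ψ x) ∂ν = ∫ x, f (ψ x) ∂ν := by
  have := hν.isProbabilityMeasure
  have hmeas (k : K) : AEStronglyMeasurable (fun x => f (k • ψ x)) ν :=
    (f.continuous.comp (continuous_const_smul k)).measurable.comp hψ |>.aestronglyMeasurable
  have hcont : Continuous fun k : K => ∫ x, f (k • ψ x) ∂ν :=
    continuous_of_dominated hmeas
      (fun k => Filter.Eventually.of_forall fun x => f.norm_coe_le_norm _) (integrable_const ‖f‖)
      (Filter.Eventually.of_forall fun x =>
        f.continuous.comp (continuous_id.smul continuous_const))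
  have h := eq_of_harmonic μ hμ hτ hcont (fun k => by
    have h1 := hν.stationary (fun x => f (k • ψ x))
      (memLp_top_of_bound (hmeas k) ‖f‖ (Filter.Eventually.of_forall fun x =>
        f.norm_coe_le_norm _))
    convert h1 using 3 with s
    refine integral_congr_ae ?_
    filter_upwards [hequiv s] with x hx
    rw [hx, mul_smul]) k 1
  simpa using h

theorem map_eq_map_haarMeasure [SecondCountableTopology E] [IsTopologicalGroup K]
    [SecondCountableTopology K] [MeasurableSpace K] [BorelSpace K]
    {μ : PMF G} (hμ : Subsemigroup.closure μ.support = ⊤)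
    (hν : IsStationarySpace μ ν) (hτ : DenseRange τ) (hψ : Measurable ψ)
    (hequiv : ∀ g : G, ∀ᵐ x ∂ν, ψ (g • x) = τ g • ψ x) {w : E}
    (hw : ∀ᵐ x ∂ν, ψ x ∈ MulAction.orbit K w) :
    ν.map ψ = (Measure.haarMeasure (⊤ : TopologicalSpace.PositiveCompacts K)).map
      (fun k => k • w) := by
  have := hν.isProbabilityMeasure
  set m := Measure.haarMeasure (⊤ : TopologicalSpace.PositiveCompacts K) with hmdef
  have : IsProbabilityMeasure m := ⟨by
    simpa using Measure.haarMeasure_self (K₀ := (⊤ : TopologicalSpace.PositiveCompacts K))⟩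
  have hcw (w : E) : Continuous fun k : K => k • w := continuous_id.smul continuous_const
  have : IsProbabilityMeasure (ν.map ψ) := Measure.isProbabilityMeasure_map hψ.aemeasurable
  have : IsProbabilityMeasure (m.map fun k => k • w) :=
    Measure.isProbabilityMeasure_map (hcw w).measurable.aemeasurable
  refine ext_of_forall_integral_eq_of_IsFiniteMeasure fun f => ?_
  rw [integral_map hψ.aemeasurable f.continuous.aestronglyMeasurable,
    integral_map (hcw w).measurable.aemeasurable f.continuous.aestronglyMeasurable]
  have hint : Integrable (Function.uncurry fun (k : K) (x : X) => f (k • ψ x)) (m.prod ν) := by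
    refine Integrable.of_bound (Measurable.aestronglyMeasurable ?_) ‖f‖
      (Filter.Eventually.of_forall fun z => f.norm_coe_le_norm _)
    exact f.continuous.measurable.comp
      (continuous_smul.measurable.comp (measurable_fst.prodMk (hψ.comp measurable_snd)))
  -- Average over `K` and swap: on the orbit of `w` the inner integral does not depend on the point,
  -- by right invariance of Haar measure.
  calc ∫ x, f (ψ x) ∂ν = ∫ _ : K, ∫ x, f (ψ x) ∂ν ∂m := by simp
    _ = ∫ k : K, ∫ x, f (k • ψ x) ∂ν ∂m := by
        simp only [integral_smul_eq hμ hν hτ hψ hequiv f]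
    _ = ∫ x, ∫ k : K, f (k • ψ x) ∂m ∂ν := integral_integral_swap hint
    _ = ∫ x, ∫ k : K, f (k • w) ∂m ∂ν := by
        refine integral_congr_ae ?_
        filter_upwards [hw] with x hx
        obtain ⟨l, hl⟩ := hx
        have h1 : ∫ k : K, f ((k * l) • w) ∂m = ∫ k : K, f (k • w) ∂m := by
          conv_rhs => rw [hmdef, ← haarMeasure_map_mul_right l]
          exact (integral_map (f := fun k => f (k • w)) (measurable_mul_const l).aemeasurable
            (f.continuous.comp (hcw w)).aestronglyMeasurable).symm
        simp only [mul_smul] at h1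
        rw [← h1, ← hl]
    _ = ∫ k : K, f (k • w) ∂m := by simp

end Orbit

/-! ### Orbits as coset spaces, and the isometric factor -/

section Isometric

theorem isIsomorphic_cosetHaar {G : Type*} [Group G] {K : Type*} [Group K] [TopologicalSpace K]
    [IsTopologicalGroup K] [CompactSpace K] [MeasurableSpace K] [BorelSpace K]
    {τ : G →* K} {E : Type*} [MetricSpace E]
    [MeasurableSpace E] [BorelSpace E] [MulAction K E] [ContinuousSMul K E]
    [MulAction G E] (hG : ∀ (g : G) (v : E), g • v = τ g • v) (w : E) :
    IsIsomorphic G ((Measure.haarMeasure (⊤ : TopologicalSpace.PositiveCompacts K)).map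
      (fun k => k • w)) (cosetHaar (MulAction.stabilizer K w) τ) := by
  set m := Measure.haarMeasure (⊤ : TopologicalSpace.PositiveCompacts K) with hmdef
  set L := MulAction.stabilizer K w
  let q : CosetSpace L τ → E := MulAction.ofQuotientStabilizer K w
  have hcw : Continuous fun k : K => k • w := continuous_id.smul continuous_const
  have hmk : Continuous (CosetSpace.mk L τ) := continuous_quotient_mk'
  have hq : Continuous q := continuous_quot_lift _ hcw
  have hinj : Function.Injective q := MulAction.injective_ofQuotientStabilizer K w
  have : CompactSpace (CosetSpace L τ) := inferInstanceAs (CompactSpace (K ⧸ L))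
  have : BorelSpace (CosetSpace L τ) := ⟨rfl⟩
  -- A continuous injection from a compact space is a closed embedding, so `q` has a Borel left
  -- inverse defined on all of `E`.
  have hemb : MeasurableEmbedding q := (hq.isClosedEmbedding hinj).measurableEmbedding
  have : Nonempty (CosetSpace L τ) := ⟨CosetSpace.mk L τ 1⟩
  have hqmk (k : K) : q (CosetSpace.mk L τ k) = k • w := rfl
  have hmem (y : CosetSpace L τ) : q y ∈ MulAction.orbit K w := by
    induction y using QuotientGroup.induction_on with
    | H k => exact ⟨k, rfl⟩
  have hsurj (v : E) (hv : v ∈ MulAction.orbit K w) : ∃ y, q y = v := by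
    obtain ⟨k, rfl⟩ := hv
    exact ⟨CosetSpace.mk L τ k, rfl⟩
  have hqeq (g : G) (y : CosetSpace L τ) : q (g • y) = g • q y := by
    rw [hG]
    exact MulAction.ofQuotientStabilizer_smul K w (τ g) y
  have hpush : m.map (fun k => k • w) = (cosetHaar L τ).map q := by
    rw [cosetHaar_eq_map, Measure.map_map hq.measurable hmk.measurable]
    rfl
  obtain ⟨p, hp, hpq⟩ : ∃ p : E → CosetSpace L τ, Measurable p ∧ ∀ y, p (q y) = y := by
    obtain ⟨p, hp, hpq⟩ := hemb.exists_measurable_extend measurable_id fun _ => this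
    exact ⟨p, hp, congrFun hpq⟩
  refine ⟨MulAction.orbit K w, univ, p, q, (isCompact_orbit w).isClosed.measurableSet, ?_, ?_,
    MeasurableSet.univ, by simp, by simp, hp, hq.measurable, mapsTo_univ _ _,
    fun y _ => hmem y, ?_, fun y _ => hpq y, ?_, ?_, hpush.symm⟩
  · rw [Measure.map_apply hcw.measurable (isCompact_orbit w).isClosed.measurableSet.compl]
    convert measure_empty (μ := m)
    ext k
    simp
  · intro g v hv
    rw [hG]
    exact (MulAction.smul_orbit_subset (τ g) w) (smul_mem_smul_set hv)
  · intro v hv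
    obtain ⟨y, rfl⟩ := hsurj v hv
    rw [hpq]
  · intro g v hv
    obtain ⟨y, rfl⟩ := hsurj v hv
    rw [← hqeq, hpq, hpq]
  · rw [hpush, Measure.map_map hp hq.measurable]
    convert Measure.map_id
    ext1 y
    exact hpq y

/-- An equivariant map to a metric space on which a compact group containing the image of `G`
acts by isometries is a factor map onto an isometric `G`-space. -/
theorem isometric_factor {G : Type*} [Group G] [Countable G] {μ : PMF G}
    (hμ : Subsemigroup.closure μ.support = ⊤)
    {X : Type*} [MeasurableSpace X] [MulAction G X] {ν : Measure X}
    (hν : IsStationarySpace μ ν) (hν_erg : IsErgodic G ν)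
    {K : Type} [Group K] [TopologicalSpace K] [IsTopologicalGroup K] [CompactSpace K] [T2Space K]
    [SecondCountableTopology K] {τ : G →* K} (hτ : DenseRange τ) {E : Type*} [MetricSpace E]
    [SecondCountableTopology E] [MeasurableSpace E] [BorelSpace E] [MulAction K E]
    [ContinuousSMul K E] [IsIsometricSMul K E] [MulAction G E]
    (hG : ∀ (g : G) (v : E), g • v = τ g • v) {ψ : X → E} (hψ : Measurable ψ)
    (hequiv : ∀ g : G, ∀ᵐ x ∂ν, ψ (g • x) = τ g • ψ x) :
    IsGSpace G (ν.map ψ) ∧ IsFactor G ν (ν.map ψ) ∧ IsIsometric G (ν.map ψ) := by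
  have := hν.isProbabilityMeasure
  have hprob : IsProbabilityMeasure (ν.map ψ) :=
    Measure.isProbabilityMeasure_map hψ.aemeasurable
  borelize K
  obtain ⟨w, hw⟩ := exists_ae_mem_orbit hν_erg hψ hequiv
  have hmap := map_eq_map_haarMeasure hμ hν hτ hψ hequiv hw
  refine ⟨⟨hprob, fun g => ?_⟩, ?_, ?_⟩
  · have hc : Continuous fun v : E => τ g • v := continuous_const_smul _
    have hc' : Continuous fun k : K => k • w := continuous_id.smul continuous_const
    simp only [hG]
    refine (MeasurePreserving.mk hc.measurable ?_).quasiMeasurePreserving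
    rw [hmap, Measure.map_map hc.measurable hc'.measurable]
    conv_rhs => rw [← map_mul_left_eq_self
      (Measure.haarMeasure (⊤ : TopologicalSpace.PositiveCompacts K)) (τ g)]
    rw [Measure.map_map hc'.measurable (measurable_const_mul _)]
    congr 1
    ext k
    exact (mul_smul _ _ _).symm
  · have hgm (g : G) : Measurable fun x : X => g • x := (hν.quasi g).measurable
    -- Demanding equivariance for all `g` at once makes this set strictly invariant; countability of
    -- `G` makes it measurable and conull.
    refine ⟨{x | ∀ g : G, ψ (g • x) = τ g • ψ x}, ψ, ?_, ?_, ?_, hψ, ?_, rfl⟩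
    · rw [ofPred_forall]
      exact MeasurableSet.iInter fun g => measurableSet_eq_fun (hψ.comp (hgm g))
        ((continuous_const_smul (τ g)).measurable.comp hψ)
    · exact ae_all_iff.2 hequiv
    · intro g x hx h
      rw [← mul_smul, hx, hx, map_mul, mul_smul]
    · intro g x hx
      rw [hG]
      exact hx g
  · refine ⟨K, _, _, inferInstance, inferInstance, inferInstance, inferInstance,
      MulAction.stabilizer K w, τ, ?_, hτ, ?_⟩
    · exact isClosed_singleton.preimage (f := fun k : K => k • w)
        (continuous_id.smul continuous_const)
    · rw [hmap]
      exact isIsomorphic_cosetHaar hG w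

end Isometric

/-! ### Compactness and actions of finite-dimensional unitary groups -/

section Unitary

variable {E : Type*} [NormedAddCommGroup E] [InnerProductSpace ℝ E]

instance isIsometricSMul_unitary [CompleteSpace E] (K : Subgroup (unitary (E →L[ℝ] E))) :
    IsIsometricSMul K E where
  isometry_smul k := (AddMonoidHomClass.isometry_iff_norm (k : E →L[ℝ] E)).2
    fun v => Unitary.norm_map (k : unitary (E →L[ℝ] E)) v

instance continuousSMul_unitary [CompleteSpace E] (K : Subgroup (unitary (E →L[ℝ] E))) :
    ContinuousSMul K E where
  continuous_smul := by
    have h : Continuous fun z : K × E => ((z.1 : unitary (E →L[ℝ] E)) : E →L[ℝ] E) :=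
      continuous_subtype_val.comp (continuous_subtype_val.comp continuous_fst)
    exact h.clm_apply continuous_snd

theorem compactSpace_unitary [FiniteDimensional ℝ E] [CompleteSpace E] :
    CompactSpace (unitary (E →L[ℝ] E)) := by
  have : ProperSpace (E →L[ℝ] E) := FiniteDimensional.proper ℝ _
  refine isCompact_iff_compactSpace.1 (Metric.isCompact_of_isClosed_isBounded
    isClosed_unitary ((Metric.isBounded_closedBall (x := 0) (r := 1)).subset fun u hu => ?_))
  rw [mem_closedBall_zero_iff]
  exact u.opNorm_le_bound zero_le_one fun v => by
    rw [one_mul]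
    exact (Unitary.norm_map ⟨u, hu⟩ v).le

end Unitary

/-! ### Compression of a representation to an invariant subspace -/

section Compression

variable {G H E : Type*} [Group G] [NormedAddCommGroup H] [InnerProductSpace ℝ H] [CompleteSpace H]
  [NormedAddCommGroup E] [InnerProductSpace ℝ E] [CompleteSpace E]

open ContinuousLinearMap

/-- An isometry onto an invariant subspace intertwines a unitary representation with its
compression. -/
theorem exists_compression (π : G →* (H ≃ₗᵢ[ℝ] H)) (J : E →ₗᵢ[ℝ] H)
    (hJ : ∀ g v, ∃ v', J v' = π g (J v)) :
    ∃ ρ : G →* unitary (E →L[ℝ] E), (∀ g v, J ((ρ g : E →L[ℝ] E) v) = π g (J v)) ∧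
      ∀ g u, adjoint J.toContinuousLinearMap (π g u) =
        (ρ g : E →L[ℝ] E) (adjoint J.toContinuousLinearMap u) := by
  set A := J.toContinuousLinearMap
  have hAA (v : E) : adjoint A (J v) = v := by
    refine ext_inner_right ℝ fun w => ?_
    rw [adjoint_inner_left]
    exact J.inner_map_map v w
  let T (g : G) : E →L[ℝ] E := adjoint A ∘L (π g : H →L[ℝ] H) ∘L A
  have hT (g : G) (v : E) : J (T g v) = π g (J v) := by
    obtain ⟨v', hv'⟩ := hJ g v
    change J (adjoint A (π g (J v))) = _
    rw [← hv', hAA]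
  have hmul (g h : G) : T (g * h) = T g * T h := by
    ext1 v
    apply J.injective
    rw [hT, show (T g * T h) v = T g (T h v) from rfl, hT, hT, map_mul]
    rfl
  have hone : T 1 = 1 := by
    ext1 v
    apply J.injective
    rw [hT, map_one]
    rfl
  have hinner (g : G) (u v : H) : inner ℝ (π g u) v = inner ℝ u (π g⁻¹ v) := by
    rw [← (π g).inner_map_map u (π g⁻¹ v),
      show π g (π g⁻¹ v) = (π g * π g⁻¹) v from rfl, ← map_mul, mul_inv_cancel, map_one]
    rfl
  -- This gives unitarity and, on passing to adjoints, the intertwining relation for the adjoint of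
  -- `J`.
  have hstar (g : G) : star (T g) = T g⁻¹ := by
    ext1 v
    refine ext_inner_right ℝ fun w => ?_
    rw [star_eq_adjoint, adjoint_inner_left, ← J.inner_map_map, hT, ← J.inner_map_map (T g⁻¹ v),
      hT, hinner, inv_inv]
  let ρ : G →* unitary (E →L[ℝ] E) :=
    { toFun g := ⟨T g, by
        rw [Unitary.mem_iff, hstar, ← hmul, ← hmul]
        simp [hone]⟩
      map_one' := Subtype.ext hone
      map_mul' g h := Subtype.ext (hmul g h) }
  refine ⟨ρ, hT, fun g u => ext_inner_right ℝ fun w => ?_⟩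
  have h1 : inner ℝ (T g (adjoint A u)) w = inner ℝ (adjoint A u) (T g⁻¹ w) := by
    rw [← hstar, star_eq_adjoint, adjoint_inner_right]
  change _ = inner ℝ (T g (adjoint A u)) w
  rw [h1, adjoint_inner_left, adjoint_inner_left, hinner]
  change _ = inner ℝ u (J (T g⁻¹ w))
  rw [hT]
  rfl

end Compression

theorem isometric_factor_of_unitary {G : Type*} [Group G] [Countable G] {μ : PMF G}
    (hμ : Subsemigroup.closure μ.support = ⊤)
    {X : Type*} [MeasurableSpace X] [MulAction G X] {ν : Measure X}
    (hν : IsStationarySpace μ ν) (hν_erg : IsErgodic G ν)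
    {E : Type} [NormedAddCommGroup E] [InnerProductSpace ℝ E] [FiniteDimensional ℝ E]
    [CompleteSpace E] [MeasurableSpace E] [BorelSpace E] (ρ : G →* unitary (E →L[ℝ] E))
    {ψ : X → E} (hψ : Measurable ψ)
    (hequiv : ∀ g : G, ∀ᵐ x ∂ν, ψ (g • x) = (ρ g : E →L[ℝ] E) (ψ x)) :
    ∃ _ : MulAction G E,
      IsGSpace G (ν.map ψ) ∧ IsFactor G ν (ν.map ψ) ∧ IsIsometric G (ν.map ψ) := by
  have : CompactSpace (unitary (E →L[ℝ] E)) := compactSpace_unitary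
  have : ProperSpace (E →L[ℝ] E) := FiniteDimensional.proper ℝ _
  have : ProperSpace E := FiniteDimensional.proper ℝ _
  have : SecondCountableTopology (E →L[ℝ] E) := secondCountable_of_proper
  have : SecondCountableTopology E := secondCountable_of_proper
  let K : Subgroup (unitary (E →L[ℝ] E)) := ρ.range.topologicalClosure
  have : CompactSpace K := isCompact_iff_compactSpace.1
    (Subgroup.isClosed_topologicalClosure _).isCompact
  let τ : G →* K := ρ.codRestrict K fun g => Subgroup.le_topologicalClosure _ ⟨g, rfl⟩
  have hτ : DenseRange τ := by
    intro k
    rw [closure_subtype, ← range_comp]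
    exact k.2
  let act : MulAction G E := MulAction.compHom E τ
  exact ⟨act, isometric_factor (K := K) hμ hν hν_erg hτ (fun _ _ => rfl) hψ hequiv⟩

/-- An equivariant map to a Hilbert space on which `G` acts by isometries yields a non-trivial
isometric factor, unless it takes values in the invariant vectors. -/
theorem exists_isometric_factor_of_hilbert {G : Type*} [Group G] [Countable G] {μ : PMF G}
    (hμ : Subsemigroup.closure μ.support = ⊤)
    {X : Type*} [MeasurableSpace X] [MulAction G X] {ν : Measure X}
    (hν : IsStationarySpace μ ν) (hν_erg : IsErgodic G ν)
    {H : Type*} [NormedAddCommGroup H] [InnerProductSpace ℝ H] [CompleteSpace H]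
    (π : G →* (H ≃ₗᵢ[ℝ] H)) {φ : X → H} (hφ : StronglyMeasurable φ) {c : ℝ}
    (hc : ∀ x, ‖φ x‖ ≤ c) (hequiv : ∀ g : G, ∀ᵐ x ∂ν, φ (g • x) = π g (φ x))
    (h0 : ¬ ∀ᵐ x ∂ν, ∀ g, π g (φ x) = φ x) :
    ∃ (W : Type) (_ : MeasurableSpace W) (_ : StandardBorelSpace W) (_ : MulAction G W)
      (ξ : Measure W),
      IsGSpace G ξ ∧ IsFactor G ν ξ ∧ ¬ IsTrivial ξ ∧ IsIsometric G ξ := by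
  have := hν.isProbabilityMeasure
  let N : Submodule ℝ H := ⨅ g, ((π g : H →L[ℝ] H) - 1 : H →L[ℝ] H).ker
  have hN (u : H) : u ∈ N ↔ ∀ g, π g u = u := by
    simp [N, Submodule.mem_iInf, sub_eq_zero]
  have hNcl : IsClosed (N : Set H) := by
    simp only [N, Submodule.coe_iInf]
    exact isClosed_iInter fun g => ContinuousLinearMap.isClosed_ker _
  have : CompleteSpace N := hNcl.completeSpace_coe
  have hinner (g : G) (u v : H) : inner ℝ (π g u) v = inner ℝ u (π g⁻¹ v) := by
    rw [← (π g).inner_map_map u (π g⁻¹ v),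
      show π g (π g⁻¹ v) = (π g * π g⁻¹) v from rfl, ← map_mul, mul_inv_cancel, map_one]
    rfl
  -- Discarding the invariant part ensures that the eigenspace found below contains no nonzero
  -- invariant vector.
  let P : H →L[ℝ] H := Nᗮ.starProjection
  have hPN (u : H) : u - P u ∈ N := by
    have h := Submodule.sub_starProjection_mem_orthogonal (K := Nᗮ) u
    rwa [Submodule.orthogonal_orthogonal] at h
  have hPo (u : H) : P u ∈ Nᗮ := Submodule.starProjection_apply_mem _ _
  have hP (g : G) (u : H) : P (π g u) = π g (P u) := by
    have h1 : P (π g u) - π g (P u) ∈ Nᗮ := by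
      refine Submodule.sub_mem _ (hPo _) fun v hv => ?_
      rw [real_inner_comm, hinner, (hN v).1 hv, real_inner_comm]
      exact hPo u v hv
    have h2 : P (π g u) - π g (P u) ∈ N := by
      have h3 : π g (u - P u) ∈ N := by
        rw [(hN _).1 (hPN u)]
        exact hPN u
      have h4 := Submodule.sub_mem _ h3 (hPN (π g u))
      rw [map_sub] at h4
      convert h4 using 1
      abel
    exact sub_eq_zero.1 (inner_self_eq_zero.1 (h1 _ h2))
  let φ' : X → H := fun x => P (φ x)
  have hφ' : StronglyMeasurable φ' := P.continuous.comp_stronglyMeasurable hφ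
  have hc' (x : X) : ‖φ' x‖ ≤ ‖P‖ * c := (P.le_opNorm _).trans (by gcongr; exact hc x)
  have hequiv' (g : G) : ∀ᵐ x ∂ν, φ' (g • x) = π g (φ' x) := by
    filter_upwards [hequiv g] with x hx
    simp only [φ', hx, hP]
  obtain ⟨V, hVfin, hV0, hVinv, hVker⟩ := exists_finiteDimensional_invariant μ hμ π hφ' hc'
    (by
      intro h
      apply h0
      filter_upwards [h] with x hx
      have h1 := hPN (φ x)
      have h2 : P (φ x) = 0 := hx
      rwa [h2, sub_zero, hN] at h1)
    (fun u => by
      have h1 := hν.stationary (fun x => inner ℝ (φ' x) u ^ 2) (memLp_top_of_bound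
        ((hφ'.inner stronglyMeasurable_const).pow 2).aestronglyMeasurable ((‖P‖ * c * ‖u‖) ^ 2)
        (Filter.Eventually.of_forall fun x => by
          rw [norm_pow]
          gcongr
          exact (norm_inner_le_norm _ _).trans (by gcongr; exact hc' x)))
      convert h1 using 3 with s
      refine integral_congr_ae ?_
      filter_upwards [hequiv' s] with x hx
      rw [hx, hinner])
  -- Coordinates replace `V` by a standard Borel space in `Type`.
  let E := EuclideanSpace ℝ (Fin (Module.finrank ℝ V))
  let J : E →ₗᵢ[ℝ] H := V.subtypeₗᵢ.comp (stdOrthonormalBasis ℝ V).repr.symm.toLinearIsometry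
  have hJV (v : E) : J v ∈ V := ((stdOrthonormalBasis ℝ V).repr.symm v).2
  have hVJ (u : H) (hu : u ∈ V) : ∃ v, J v = u :=
    ⟨(stdOrthonormalBasis ℝ V).repr ⟨u, hu⟩, by simp [J]⟩
  obtain ⟨ρ, hρJ, hρ⟩ := exists_compression π J fun g v => hVJ _ (hVinv g _ (hJV v))
  let ψ : X → E := fun x => ContinuousLinearMap.adjoint J.toContinuousLinearMap (φ' x)
  have hψ : Measurable ψ :=
    ((ContinuousLinearMap.continuous _).comp_stronglyMeasurable hφ').measurable
  have hψ_inner (x : X) (v : E) : inner ℝ (ψ x) v = inner ℝ (φ' x) (J v) :=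
    ContinuousLinearMap.adjoint_inner_left _ _ _
  -- A constant value `v` would be invariant, so `J v` lies in `N` and in `V`, which is orthogonal
  -- to `N`; thus `v = 0`. Then `φ'` is a.e. orthogonal to each vector of `V`, forcing `V = ⊥`.
  have hconst : ¬ ∃ v, ∀ᵐ x ∂ν, ψ x = v := by
    rintro ⟨v, hv⟩
    have hvN : J v ∈ N := by
      rw [hN]
      intro g
      obtain ⟨x, hx1, hx2, hx3⟩ := (hv.and (((hν.quasi g).ae hv).and (hequiv' g))).exists
      have h1 := hρ g (φ' x)
      rw [← hx3] at h1
      change ψ (g • x) = (ρ g : E →L[ℝ] E) (ψ x) at h1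
      rw [hx1, hx2] at h1
      rw [← hρJ, ← h1]
    have h1 := hVker (J v)
      (Filter.Eventually.of_forall fun x => by rw [real_inner_comm]; exact hPo _ _ hvN)
      (J v) (hJV v)
    have hv0 : v = 0 := by
      rw [inner_self_eq_zero] at h1
      exact J.injective (by rw [h1, map_zero])
    refine hV0 ((Submodule.eq_bot_iff _).2 fun u hu => ?_)
    obtain ⟨v', rfl⟩ := hVJ u hu
    refine inner_self_eq_zero.1 (hVker (J v') ?_ (J v') hu)
    filter_upwards [hv] with x hx
    rw [← hψ_inner, hx, hv0, inner_zero_left]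
  obtain ⟨inst, h1, h2, h3⟩ := isometric_factor_of_unitary hμ hν hν_erg ρ hψ fun g => by
    filter_upwards [hequiv' g] with x hx
    simp only [ψ, hx]
    exact hρ g _
  refine ⟨E, inferInstance, inferInstance, inst, ν.map ψ, h1, h2, ?_, h3⟩
  rintro ⟨w, hw⟩
  exact hconst ⟨w, ae_of_ae_map hψ.aemeasurable hw⟩

/-! ### The Koopman representation -/

section Koopman

variable {G Y : Type*} [Group G] [MeasurableSpace Y] [MulAction G Y] {η : Measure Y}

/-- The Koopman representation `(g f)(y) = f (g⁻¹ y)` on `L²`. -/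
noncomputable def koopman (h : ∀ g : G, MeasurePreserving (fun y : Y => g • y) η η) :
    G →* (Lp ℝ 2 η ≃ₗᵢ[ℝ] Lp ℝ 2 η) :=
  have hmul (g k : G) (f : Lp ℝ 2 η) : Lp.compMeasurePreserving _ (h (g * k)) f =
      Lp.compMeasurePreserving _ (h k) (Lp.compMeasurePreserving _ (h g) f) := by
    rw [← Lp.compMeasurePreserving_comp_apply]
    congr! 2
    ext y
    exact mul_smul _ _ _
  have hone (f : Lp ℝ 2 η) : Lp.compMeasurePreserving _ (h 1) f = f := by
    conv_rhs => rw [← Lp.compMeasurePreserving_id_apply f]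
    congr! 2
    ext y
    exact one_smul _ _
  { toFun g := LinearIsometryEquiv.ofSurjective
      (Lp.compMeasurePreservingₗᵢ ℝ (fun y : Y => g⁻¹ • y) (h g⁻¹)) fun f =>
        ⟨Lp.compMeasurePreserving _ (h g) f, by
          change Lp.compMeasurePreserving _ (h g⁻¹) _ = f
          rw [← hmul]
          simp only [mul_inv_cancel]
          exact hone f⟩
    map_one' := by
      ext1 f
      change Lp.compMeasurePreserving _ (h 1⁻¹) f = f
      simp only [inv_one]
      exact hone f
    map_mul' g k := by
      ext1 f
      change Lp.compMeasurePreserving _ (h (g * k)⁻¹) f =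
        Lp.compMeasurePreserving _ (h g⁻¹) (Lp.compMeasurePreserving _ (h k⁻¹) f)
      simp only [mul_inv_rev]
      exact hmul _ _ f }

theorem koopman_indicatorConstLp [IsFiniteMeasure η]
    (h : ∀ g : G, MeasurePreserving (fun y : Y => g • y) η η) (g : G) {s : Set Y}
    (hs : MeasurableSet s) :
    koopman h g (indicatorConstLp 2 hs (measure_ne_top η s) 1) =
      indicatorConstLp 2 (hs.preimage (h g⁻¹).measurable) (measure_ne_top η _) 1 :=
  rfl

end Koopman

/-! ### Measurability of the section map into `L²` -/

section Sections

variable {X Y : Type*} [MeasurableSpace X] [MeasurableSpace Y] (η : Measure Y) [IsFiniteMeasure η]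

/-- The indicator function of the vertical section `{y | (x, y) ∈ B}` in `L²`. -/
noncomputable def sectionLp {B : Set (X × Y)} (hB : MeasurableSet B) (x : X) : Lp ℝ 2 η :=
  indicatorConstLp 2 (measurable_prodMk_left (x := x) hB) (measure_ne_top η _) 1

variable {η}

theorem indicatorConstLp_congr_ae {s t : Set Y} (hs : MeasurableSet s) (ht : MeasurableSet t)
    (h : s =ᵐ[η] t) : indicatorConstLp 2 hs (measure_ne_top η s) (1 : ℝ) =
      indicatorConstLp 2 ht (measure_ne_top η t) 1 :=
  (MemLp.toLp_eq_toLp_iff _ _).2 (indicator_ae_eq_of_ae_eq_set h)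

theorem indicatorConstLp_compl {s : Set Y} (hs : MeasurableSet s) :
    indicatorConstLp 2 hs.compl (measure_ne_top η sᶜ) (1 : ℝ) =
      indicatorConstLp 2 MeasurableSet.univ (measure_ne_top η univ) 1 -
        indicatorConstLp 2 hs (measure_ne_top η s) 1 := by
  rw [eq_sub_iff_add_eq', ← indicatorConstLp_disjoint_union hs hs.compl (measure_ne_top η s)
    (measure_ne_top η sᶜ) disjoint_compl_right]
  exact indicatorConstLp_congr_ae _ _ (Filter.EventuallyEq.of_eq (union_compl_self s))

theorem stronglyMeasurable_sectionLp_biUnion_Iio {f : ℕ → Set (X × Y)}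
    (hd : Pairwise (Function.onFun Disjoint f)) (hf : ∀ i, MeasurableSet (f i))
    (h : ∀ i, StronglyMeasurable (sectionLp η (hf i))) (n : ℕ) :
    StronglyMeasurable (sectionLp η (MeasurableSet.biUnion (Set.to_countable (Iio n))
      fun i _ => hf i)) := by
  induction n with
  | zero =>
    convert stronglyMeasurable_const (b := (0 : Lp ℝ 2 η)) with x
    rw [← indicatorConstLp_empty (p := 2) (μ := η) (c := (1 : ℝ))]
    exact indicatorConstLp_congr_ae _ _ (by simp)
  | succ n ih =>
    convert ih.add (h n) using 1
    ext1 x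
    rw [Pi.add_apply, sectionLp, sectionLp, sectionLp, ← indicatorConstLp_disjoint_union]
    · exact indicatorConstLp_congr_ae _ _ (Filter.EventuallyEq.of_eq
        (congrArg (preimage (Prod.mk x)) (biUnion_lt_succ f n)))
    · refine Disjoint.preimage _ ?_
      rw [disjoint_iUnion₂_left]
      exact fun i hi => hd (ne_of_lt hi)

/-- `L²(η)` may be non-separable, so strong measurability is proved by induction from rectangles;
countable disjoint unions are pointwise `L²` limits of finite ones. -/
theorem stronglyMeasurable_sectionLp {B : Set (X × Y)} (hB : MeasurableSet B) :
    StronglyMeasurable (sectionLp η hB) := by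
  induction B, hB using MeasurableSpace.induction_on_inter generateFrom_prod.symm isPiSystem_prod with
  | empty =>
    convert stronglyMeasurable_const (b := (0 : Lp ℝ 2 η)) with x
    exact indicatorConstLp_empty
  | basic B hB =>
    obtain ⟨s, hs, t, ht, rfl⟩ := hB
    convert (stronglyMeasurable_const
      (b := indicatorConstLp 2 ht (measure_ne_top η t) (1 : ℝ))).indicator hs using 1
    ext1 x
    by_cases hx : x ∈ s
    · rw [indicator_of_mem hx]
      exact indicatorConstLp_congr_ae _ _ (Filter.EventuallyEq.of_eq (mk_preimage_prod_right hx))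
    · rw [indicator_of_notMem hx, ← indicatorConstLp_empty (p := 2) (μ := η) (c := (1 : ℝ))]
      exact indicatorConstLp_congr_ae _ _ (Filter.EventuallyEq.of_eq
        (mk_preimage_prod_right_eq_empty hx))
  | compl B hB ih =>
    convert (stronglyMeasurable_const
      (b := indicatorConstLp 2 MeasurableSet.univ (measure_ne_top η univ) (1 : ℝ))).sub ih using 1
    ext1 x
    exact indicatorConstLp_compl _
  | iUnion f hd hf ih =>
    refine stronglyMeasurable_of_tendsto Filter.atTop
      (fun n => stronglyMeasurable_sectionLp_biUnion_Iio hd hf ih n)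
      (tendsto_pi_nhds.2 fun x => tendsto_indicatorConstLp_set ENNReal.ofNat_ne_top ?_)
    have hmono : Antitone fun n : ℕ => (⋃ i, Prod.mk x ⁻¹' f i) \ ⋃ i ∈ Iio n, Prod.mk x ⁻¹' f i :=
      fun m n hmn => sdiff_subset_sdiff_right
        (biUnion_subset_biUnion_left (Iio_subset_Iio hmn))
    have h1 := tendsto_measure_iInter_atTop (μ := η) (fun n => (MeasurableSet.diff
      (MeasurableSet.iUnion fun i => measurable_prodMk_left (x := x) (hf i))
      (MeasurableSet.biUnion (Set.to_countable (Iio n))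
        fun i _ => measurable_prodMk_left (x := x) (hf i))).nullMeasurableSet) hmono
      ⟨0, measure_ne_top _ _⟩
    have h2 : ⋂ n : ℕ, ((⋃ i, Prod.mk x ⁻¹' f i) \ ⋃ i ∈ Iio n, Prod.mk x ⁻¹' f i) = ∅ := by
      ext y
      simp only [mem_iInter, mem_sdiff, mem_iUnion, mem_Iio, mem_empty_iff_false, iff_false,
        not_forall]
      by_contra! hy
      obtain ⟨i, hi⟩ := (hy 0).1
      exact (hy (i + 1)).2 i (Nat.lt_succ_self i) hi
    rw [h2, measure_empty] at h1
    convert h1 using 2 with n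
    simp only [preimage_iUnion]
    congr 1
    exact symmDiff_of_le (iUnion₂_subset fun i _ => subset_iUnion (fun i => Prod.mk x ⁻¹' f i) i)

end Sections

end GDyn

/-! ### The theorem, from the sections of an invariant set -/

theorem theorem4p1 {G : Type*} [Group G] [Countable G] (μ : PMF G)
    (hμ : Subsemigroup.closure μ.support = ⊤)
    {X : Type*} [MeasurableSpace X] [MulAction G X] (ν : Measure X)
    (hν : GDyn.IsStationarySpace μ ν) (hν_erg : GDyn.IsErgodic G ν)
    {Y : Type*} [MeasurableSpace Y] [MulAction G Y] (η : Measure Y)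
    (hη : GDyn.IsGSpace G η) (hη_inv : ∀ g : G, MeasurePreserving (fun y : Y => g • y) η η)
    (hη_erg : GDyn.IsErgodic G η)
    (hprod : ¬ GDyn.IsErgodic G (ν.prod η)) :
    ∃ (W : Type) (_ : MeasurableSpace W) (_ : StandardBorelSpace W) (_ : MulAction G W)
      (ξ : Measure W),
      GDyn.IsGSpace G ξ ∧ GDyn.IsFactor G ν ξ ∧ ¬ GDyn.IsTrivial ξ ∧ GDyn.IsIsometric G ξ := by
  have := hν.isProbabilityMeasure
  have := hη.isProbabilityMeasure
  rw [GDyn.IsErgodic] at hprod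
  push Not at hprod
  obtain ⟨B, hB, hinv, hB0, hB1⟩ := hprod
  have hsec (g : G) : ∀ᵐ x ∂ν,
      Prod.mk (g • x) ⁻¹' B =ᵐ[η] (fun y => g⁻¹ • y) ⁻¹' (Prod.mk x ⁻¹' B) := by
    have h1 := (GDyn.measure_symmDiff_smul_eq_zero_iff _ _).1 (hinv g⁻¹)
    -- Almost everywhere `(g x, g y) ∈ B ↔ (x, y) ∈ B`; replacing `y` by `g⁻¹ y` compares the
    -- section at `g x` with the translated section at `x`.
    filter_upwards [Measure.ae_ae_of_ae_prod h1] with x hx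
    rw [Filter.eventuallyEq_set]
    filter_upwards [(hη.quasi g⁻¹).ae hx] with y hy
    simpa using hy
  refine GDyn.exists_isometric_factor_of_hilbert hμ hν hν_erg (GDyn.koopman hη_inv)
    (GDyn.stronglyMeasurable_sectionLp (η := η) hB) (c := 1) (fun x => ?_) (fun g => ?_) fun h => ?_
  · refine norm_indicatorConstLp_le.trans ?_
    rw [norm_one, one_mul]
    exact Real.rpow_le_one measureReal_nonneg measureReal_le_one (by simp)
  · filter_upwards [hsec g] with x hx
    rw [GDyn.sectionLp, GDyn.sectionLp, GDyn.koopman_indicatorConstLp]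
    exact GDyn.indicatorConstLp_congr_ae _ _ hx
  · have h01 : ∀ᵐ x ∂ν, η (Prod.mk x ⁻¹' B) = 0 ∨ η (Prod.mk x ⁻¹' B)ᶜ = 0 := by
      filter_upwards [h] with x hx
      refine hη_erg.measure_eq_zero_or (measurable_prodMk_left hB) fun g => ?_
      have h1 := hx g⁻¹
      rw [GDyn.sectionLp, GDyn.koopman_indicatorConstLp] at h1
      have h2 := (indicatorConstLp_inj _ _ _ _ one_ne_zero).1 h1
      simp only [inv_inv] at h2
      exact Filter.eventuallyEq_set.1 h2
    -- This set is almost invariant because `η` is preserved, so almost all sections are null or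
    -- almost all are conull.
    have hm : MeasurableSet {x | η (Prod.mk x ⁻¹' B) = 0} :=
      measurable_measure_prodMk_left hB (measurableSet_singleton 0)
    rcases hν_erg.measure_eq_zero_or hm (fun g => by
      filter_upwards [hsec g] with x hx
      rw [measure_congr hx, (hη_inv g⁻¹).measure_preimage
        (measurable_prodMk_left hB).nullMeasurableSet]) with h0 | h1
    · refine hB1 ((Measure.measure_prod_null hB.compl).2 ?_)
      filter_upwards [h01, measure_eq_zero_iff_ae_notMem.1 h0] with x hx hx'
      exact hx.resolve_left hx'
    · refine hB0 ((Measure.measure_prod_null hB).2 ?_)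
      filter_upwards [measure_eq_zero_iff_ae_notMem.1 h1] with x hx
      simpa using hx
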